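/- **Proposition 2.** Let $0\le\alpha<\tfrac12$ and $0\le\gamma\le 1$, and consider the following selfish-mining decision problem $M=\langle S,A,P,R\rangle$. States are triples $(a,h,\mathit{fork})$ with $a,h\in\mathbb N$ and $\mathit{fork}\in\{\text{irrelevant},\text{relevant},\text{active}\}$. The actions are *adopt* and *wait* (always feasible), *override* (feasible iff $a>h$) and *match* (feasible iff $\mathit{fork}$ is relevant and $a\ge h$). The initial state $X_0$ is $(1,0,\text{irrelevant})$ with probability $\alpha$ and $(0,1,\text{irrelevant})$ with probability $1-\alpha$. Transitions and rewards in $\mathbb N^2$ (attacker, honest network) are: - *adopt*: the next state is distributed as $X_0$, reward $(0,h)$; - *override*: to $(a-h,0,\text{irrelevant})$ with probability $\alpha$, to $(a-h-1,1,\text{relevant})$ with probability $1-\alpha$, reward $(h+1,0)$; - *wait* with $\mathit{fork}$ irrelevant or relevant: to $(a+1,h,\text{irrelevant})$ with probability $\alpha$, to $(a,h+1,\text{relevant})$ with probability $1-\alpha$, reward $(0,0)$; - *match*, or *wait* with $\mathit{fork}$ active: to $(a+1,h,\text{active})$ with probability $\alpha$, reward $(0,0)$; to $(a-h,1,\text{relevant})$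 with probability $\gamma(1-\alpha)$, reward $(h,0)$; to $(a,h+1,\text{relevant})$ with probability $(1-\gamma)(1-\alpha)$, reward $(0,0)$. A policy $\pi$ assigns a feasible action to every state; it is admissible if at any time the expected time until the next action other than *wait* is finite. Let $r_t(\pi)=(r^1_t(\pi),r^2_t(\pi))$ be the reward of the transition from $X_t$ to $X_{t+1}$ under $\pi$, and $$\mathrm{REV}(\pi)=\mathbb E\left[\liminf_{T\to\infty}\frac{\sum_{t=1}^T r^1_t(\pi)}{\sum_{t=1}^T\left(r^1_t(\pi)+r^2_t(\pi)\right)}\right].$$ For $\rho\in[0,1]$ let $w_\rho(x,y)=(1-\rho)x-\rho y$, let $M_\rho$ be the Markov decision process with the same states, actions and transitions and with the rewards $w_\rho(R)$, and let $$v^\pi_\rho=\mathbb E\left[\liminf_{T\to\infty}\frac1T\sum_{t=1}^T w_\rho(r_t(\pi))\right],\qquad v^*_\rho=\sup_{\pi\text{ admissible}}v^\pi_\rho .$$ 1. If $v^*_\rho=0$ for some $\rho\in[0,1]$, then every admissible policy $\pi^*$ with $v^{\pi^*}_\rho=0$ maximizes $\mathrm{REV}$ over the admissible policies, and $\rho=\mathrm{REV}(\pi^*)$.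 2. $v^*_\rho$ is strictly decreasing in $\rho$ on $[0,1]$. -/

import Mathlib

open MeasureTheory Filter
open scoped ENNReal

noncomputable section

namespace SelfishMining

/-- The label `fork` of a state. -/
inductive Fork
  | irrelevant
  | relevant
  | active

/-- A state `(a, h, fork)`: `a` blocks of the attacker and `h` blocks of the honest network have
been built after the latest fork. -/
structure State where
  a : ℕ
  h : ℕ
  fork : Fork

/-- The actions of the attacker. -/
inductive Action
  | adopt
  | override
  | matching
  | wait

/-- The creator of a block: the attacker, or an honest node. Honest nodes are divided into those to
which the attacker manages to deliver a competing block first (a fraction `γ` of the honest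
computational power; they work on the attacker's branch in a block race) and the others. -/
inductive Creator
  | attacker
  | honestReached
  | honestOther

instance : MeasurableSpace Creator := ⊤

/-- The law of the creator of one block: the attacker with probability `α`, a reached honest node
with probability `γ (1 - α)`, another honest node with probability `(1 - γ) (1 - α)`. -/
def blockLaw (α γ : ℝ) : Measure Creator :=
  ENNReal.ofReal α • Measure.dirac Creator.attacker
    + ENNReal.ofReal (γ * (1 - α)) • Measure.dirac Creator.honestReached
    + ENNReal.ofReal ((1 - γ) * (1 - α)) • Measure.dirac Creator.honestOther

/-- The creators of the successive blocks are independent with law `blockLaw α γ`. -/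
def blocksLaw (α γ : ℝ) : Measure (ℕ → Creator) :=
  Measure.infinitePi (fun _ : ℕ => blockLaw α γ)

/-- Feasibility of an action at a state. -/
def Feasible (x : State) : Action → Prop
  | .adopt => True
  | .override => x.h < x.a
  | .matching => x.fork = Fork.relevant ∧ x.h ≤ x.a
  | .wait => True

/-- The state at the start of the game, and after every `adopt`. -/
def start : Creator → State
  | .attacker => ⟨1, 0, .irrelevant⟩
  | _ => ⟨0, 1, .irrelevant⟩

/-- The transition during a block race (the attacker's branch competes with the honest one). -/
def raceNext (x : State) : Creator → State
  | .attacker => ⟨x.a + 1, x.h, .active⟩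
  | .honestReached => ⟨x.a - x.h, 1, .relevant⟩
  | .honestOther => ⟨x.a, x.h + 1, .relevant⟩

/-- The reward during a block race. -/
def raceReward (x : State) : Creator → ℕ × ℕ
  | .honestReached => (x.h, 0)
  | _ => (0, 0)

/-- The state that follows the state `x` under the action `u` if the next block has the given
creator. Together with `blockLaw` this is the transition matrix `P`. (Values at infeasible pairs
`(x, u)` are never used; active states with `a < h` are never reached.) -/
def next (x : State) (u : Action) (b : Creator) : State :=
  match u with
  | .adopt => start b
  | .override =>
    match b with
    | .attacker => ⟨x.a - x.h, 0, .irrelevant⟩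
    | _ => ⟨x.a - x.h - 1, 1, .relevant⟩
  | .matching => raceNext x b
  | .wait =>
    match x.fork with
    | .active => raceNext x b
    | _ =>
      match b with
      | .attacker => ⟨x.a + 1, x.h, .irrelevant⟩
      | _ => ⟨x.a, x.h + 1, .relevant⟩

/-- The immediate reward `R`: the numbers of blocks of the attacker and of the honest network that
become accepted by all parties in this transition. -/
def reward (x : State) (u : Action) (b : Creator) : ℕ × ℕ :=
  match u with
  | .adopt => (0, x.h)
  | .override => (x.h + 1, 0)
  | .matching => raceReward x b
  | .wait =>
    match x.fork with
    | .active => raceReward x b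
    | _ => (0, 0)

/-- A policy prescribes a feasible action at every state. -/
structure Policy where
  act : State → Action
  feasible : ∀ x, Feasible x (act x)

/-- The state `X_t` visited at time `t` under the policy `π`; `ω t` is the creator of the block
whose creation leads to `X_t`. -/
def stateAt (π : Policy) (ω : ℕ → Creator) : ℕ → State
  | 0 => start (ω 0)
  | t + 1 => next (stateAt π ω t) (π.act (stateAt π ω t)) (ω (t + 1))

/-- The immediate reward `r_t` of the transition from `X_t` to `X_{t+1}` under the policy `π`. -/
def rewardAt (π : Policy) (ω : ℕ → Creator) (t : ℕ) : ℕ × ℕ :=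
  reward (stateAt π ω t) (π.act (stateAt π ω t)) (ω (t + 1))

/-- The time from `t` until the next non-null action (any action but `wait`); it is `∞` if there is
none. -/
def nextActionDelay (π : Policy) (ω : ℕ → Creator) (t : ℕ) : ℝ≥0∞ :=
  ⨅ (n : ℕ) (_ : π.act (stateAt π ω (t + n)) ≠ Action.wait), (n : ℝ≥0∞)

/-- A policy is admissible if at any time the expected time until the next non-null action is
finite. -/
def Admissible (α γ : ℝ) (π : Policy) : Prop :=
  ∀ t : ℕ, ∫⁻ ω, nextActionDelay π ω t ∂(blocksLaw α γ) < ∞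

/-- The relative revenue of the attacker under the policy `π`. -/
def REV (α γ : ℝ) (π : Policy) : ℝ :=
  ∫ ω, liminf (fun T : ℕ =>
      (∑ t ∈ Finset.Icc 1 T, ((rewardAt π ω t).1 : ℝ)) /
        (∑ t ∈ Finset.Icc 1 T, (((rewardAt π ω t).1 : ℝ) + ((rewardAt π ω t).2 : ℝ)))) atTop
    ∂(blocksLaw α γ)

/-- The linear transformation `w_ρ` of the rewards. -/
def linearReward (ρ : ℝ) (r : ℕ × ℕ) : ℝ :=
  (1 - ρ) * (r.1 : ℝ) - ρ * (r.2 : ℝ)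

/-- The expected mean revenue `v^π_ρ` of the policy `π` in the Markov decision process `M_ρ`, which
has the states, actions and transitions above and the immediate rewards `w_ρ(R)`. -/
def value (α γ ρ : ℝ) (π : Policy) : ℝ :=
  ∫ ω, liminf (fun T : ℕ =>
      (1 / (T : ℝ)) * ∑ t ∈ Finset.Icc 1 T, linearReward ρ (rewardAt π ω t)) atTop
    ∂(blocksLaw α γ)

/-- The value `v^*_ρ` of `M_ρ`: the optimum of `v^π_ρ` over the admissible policies `π`. -/
def optimalValue (α γ ρ : ℝ) : ℝ :=
  sSup {v : ℝ | ∃ π : Policy, Admissible α γ π ∧ v = value α γ ρ π}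

end SelfishMining

end

namespace SelfishMining

open ProbabilityTheory Topology

/-! Every admissible policy has two numbers `p`, `q` with `p + q ≥ 1 - α`, `REV = p / (p + q)` and
`v_ρ = (1 - ρ) p - ρ q = p - ρ (p + q)` for all `ρ` in `[0, 1]` (`Admissible.exists_rates`). Hence
`v_ρ` has the sign of `REV - ρ`, which gives the first claim, and `v_ρ` falls in `ρ` with slope at
least `1 - α`, uniformly in the policy, which gives the second.

The numbers come from renewal theory: each `adopt` restarts the game, so the cycles between
adoptions are independent and identically distributed. Since `α < 1/2`, the attacker finally falls
behind for good; then only `adopt` and `wait` are feasible, and admissibility forces an `adopt`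
(`exists_adopt`). Before it, the attacker is paid only while not behind, an event of exponentially
small probability, so the attacker's revenue per cycle is integrable
(`lintegral_attackerCycle_lt_top`).

If the mean cycle length is finite, the strong law gives true limits. If it is infinite, the
attacker's share vanishes along the ends of cycles, and the lower limits are those of `p = 0`, `q =
1 - α`. -/

/-- The number (0 or 1) of blocks of the attacker among the given block. -/
def attackerCount : Creator → ℕ
  | .attacker => 1
  | _ => 0

/-- The number (0 or 1) of honest blocks among the given block. -/
def honestCount : Creator → ℕ
  | .attacker => 0
  | _ => 1

lemma attackerCount_add_honestCount (b : Creator) : attackerCount b + honestCount b = 1 := by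
  cases b <;> rfl

/-- The accepted blocks of the attacker in the first `T` transitions. -/
def attackerTotal (π : Policy) (ω : ℕ → Creator) (T : ℕ) : ℕ :=
  ∑ t ∈ Finset.range T, (rewardAt π ω t).1

/-- The accepted blocks of the honest network in the first `T` transitions. -/
def honestTotal (π : Policy) (ω : ℕ → Creator) (T : ℕ) : ℕ :=
  ∑ t ∈ Finset.range T, (rewardAt π ω t).2

lemma attackerTotal_succ (π : Policy) (ω : ℕ → Creator) (T : ℕ) :
    attackerTotal π ω (T + 1) = attackerTotal π ω T + (rewardAt π ω T).1 :=
  Finset.sum_range_succ _ _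

lemma honestTotal_succ (π : Policy) (ω : ℕ → Creator) (T : ℕ) :
    honestTotal π ω (T + 1) = honestTotal π ω T + (rewardAt π ω T).2 :=
  Finset.sum_range_succ _ _

/-! ### One-step accounting of blocks -/

/-- A race starts by a `matching`, which needs `h ≤ a`, and stays active only when the attacker
finds a block. This keeps the truncated subtraction `a - h` of a race exact. -/
lemma active_next {x : State} {u : Action} {b : Creator} (hx : x.fork = Fork.active → x.h ≤ x.a)
    (hu : Feasible x u) : (next x u b).fork = Fork.active → (next x u b).h ≤ (next x u b).a := by
  obtain ⟨a, h, f⟩ := x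
  cases u <;> cases f <;> cases b <;> simp_all [next, start, raceNext, Feasible] <;> omega

lemma active_stateAt (π : Policy) (ω : ℕ → Creator) (t : ℕ) :
    (stateAt π ω t).fork = Fork.active → (stateAt π ω t).h ≤ (stateAt π ω t).a := by
  induction t with
  | zero => cases hb : ω 0 <;> simp [stateAt, hb, start]
  | succ t ih => exact active_next ih (π.feasible _)

lemma attacker_step {x : State} {u : Action} {b : Creator}
    (hx : x.fork = Fork.active → x.h ≤ x.a) (hu : Feasible x u) :
    (reward x u b).1 + (next x u b).a ≤ x.a + attackerCount b := by
  obtain ⟨a, h, f⟩ := x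
  cases u <;> cases f <;> cases b <;>
    simp_all [next, start, raceNext, reward, raceReward, Feasible, attackerCount] <;> omega

lemma honest_step {x : State} {u : Action} {b : Creator} :
    (reward x u b).2 + (next x u b).h ≤ x.h + honestCount b := by
  obtain ⟨a, h, f⟩ := x
  cases u <;> cases f <;> cases b <;>
    simp_all [next, start, raceNext, reward, raceReward, honestCount]

/-- The `h` public blocks give way only to at least as many accepted ones, so every honest block
lengthens the chain, whoever is finally paid for it. -/
lemma chain_step {x : State} {u : Action} {b : Creator} :
    x.h + honestCount b ≤ (reward x u b).1 + (reward x u b).2 + (next x u b).h := by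
  obtain ⟨a, h, f⟩ := x
  cases u <;> cases f <;> cases b <;>
    simp_all [next, start, raceNext, reward, raceReward, honestCount]

lemma lead_step {x : State} {u : Action} {b : Creator}
    (hx : x.fork = Fork.active → x.h ≤ x.a) (hu : Feasible x u) (hne : u ≠ Action.adopt) :
    ((next x u b).a : ℤ) - (next x u b).h ≤ x.a - x.h + (attackerCount b - honestCount b) := by
  obtain ⟨a, h, f⟩ := x
  cases u <;> cases f <;> cases b <;>
    simp_all [next, raceNext, Feasible, attackerCount, honestCount] <;> omega

lemma reward_fst_le {x : State} {u : Action} {b : Creator}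
    (hx : x.fork = Fork.active → x.h ≤ x.a) (hu : Feasible x u) : (reward x u b).1 ≤ x.a := by
  obtain ⟨a, h, f⟩ := x
  cases u <;> cases f <;> cases b <;> simp_all [reward, raceReward, Feasible]

/-- Behind, `override` and `matching` are infeasible and no race is active. -/
lemma reward_fst_eq_zero {x : State} {u : Action} {b : Creator}
    (hx : x.fork = Fork.active → x.h ≤ x.a) (hu : Feasible x u) (hlt : x.a < x.h) :
    (reward x u b).1 = 0 := by
  obtain ⟨a, h, f⟩ := x
  cases u <;> cases f <;> cases b <;> simp_all [reward, raceReward, Feasible] <;> omega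

lemma eq_adopt_or_eq_wait {x : State} {u : Action} (hu : Feasible x u) (hlt : x.a < x.h) :
    u = Action.adopt ∨ u = Action.wait := by
  cases u <;> simp_all [Feasible] <;> omega

/-! ### Accounting along a path -/

section Totals

variable (π : Policy) (ω : ℕ → Creator)

lemma attackerTotal_add_le (t : ℕ) :
    attackerTotal π ω t + (stateAt π ω t).a ≤ ∑ s ∈ Finset.range (t + 1), attackerCount (ω s) := by
  induction t with
  | zero => cases hb : ω 0 <;> simp [stateAt, hb, start, attackerTotal, attackerCount]
  | succ t ih =>
    have := attacker_step (b := ω (t + 1)) (active_stateAt π ω t) (π.feasible _)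
    rw [attackerTotal_succ, Finset.sum_range_succ _ (t + 1)]
    simp only [stateAt, rewardAt]
    omega

lemma honestTotal_add_le (t : ℕ) :
    honestTotal π ω t + (stateAt π ω t).h ≤ ∑ s ∈ Finset.range (t + 1), honestCount (ω s) := by
  induction t with
  | zero => cases hb : ω 0 <;> simp [stateAt, hb, start, honestTotal, honestCount]
  | succ t ih =>
    have := honest_step (x := stateAt π ω t) (u := π.act (stateAt π ω t)) (b := ω (t + 1))
    rw [honestTotal_succ, Finset.sum_range_succ _ (t + 1)]
    simp only [stateAt, rewardAt]
    omega

lemma le_totals_add (t : ℕ) :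
    ∑ s ∈ Finset.range (t + 1), honestCount (ω s) ≤
      attackerTotal π ω t + honestTotal π ω t + (stateAt π ω t).h := by
  induction t with
  | zero =>
    cases hb : ω 0 <;> simp [stateAt, hb, start, honestTotal, attackerTotal, honestCount]
  | succ t ih =>
    have := chain_step (x := stateAt π ω t) (u := π.act (stateAt π ω t)) (b := ω (t + 1))
    rw [honestTotal_succ, attackerTotal_succ, Finset.sum_range_succ _ (t + 1)]
    simp only [stateAt, rewardAt]
    omega

lemma sum_attackerCount_le (t : ℕ) : ∑ s ∈ Finset.range t, attackerCount (ω s) ≤ t := by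
  simpa using Finset.sum_le_card_nsmul (Finset.range t) (fun s => attackerCount (ω s)) 1
    fun s _ => by have := attackerCount_add_honestCount (ω s); omega

lemma sum_honestCount_le (t : ℕ) : ∑ s ∈ Finset.range t, honestCount (ω s) ≤ t := by
  simpa using Finset.sum_le_card_nsmul (Finset.range t) (fun s => honestCount (ω s)) 1
    fun s _ => by have := attackerCount_add_honestCount (ω s); omega

/-- The lead of the attacker over the honest network in numbers of created blocks. -/
def blockLead (ω : ℕ → Creator) (t : ℕ) : ℤ :=
  ∑ s ∈ Finset.range (t + 1), ((attackerCount (ω s) : ℤ) - honestCount (ω s))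

lemma lead_le_blockLead {t : ℕ} (h : ∀ s < t, π.act (stateAt π ω s) ≠ Action.adopt) :
    ((stateAt π ω t).a : ℤ) - (stateAt π ω t).h ≤ blockLead ω t := by
  induction t with
  | zero =>
    cases hb : ω 0 <;> simp [stateAt, hb, start, blockLead, attackerCount, honestCount]
  | succ t ih =>
    have h1 := ih fun s hs => h s (by omega)
    have h2 := lead_step (b := ω (t + 1)) (active_stateAt π ω t) (π.feasible _) (h t (by omega))
    have h3 : blockLead ω (t + 1) =
        blockLead ω t + ((attackerCount (ω (t + 1)) : ℤ) - honestCount (ω (t + 1))) :=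
      Finset.sum_range_succ _ _
    simp only [stateAt]
    omega

/-- A linear bound suffices while the lead is nonnegative, because that event has an exponentially
small probability. -/
lemma rewardAt_fst_le {t : ℕ} (h : ∀ s < t, π.act (stateAt π ω s) ≠ Action.adopt) :
    (rewardAt π ω t).1 ≤ if 0 ≤ blockLead ω t then t + 1 else 0 := by
  split_ifs with h0
  · have h1 := reward_fst_le (b := ω (t + 1)) (active_stateAt π ω t) (π.feasible _)
    have h2 := attackerTotal_add_le π ω t
    have h3 := sum_attackerCount_le ω (t + 1)
    simp only [rewardAt]
    omega
  · have h1 := lead_le_blockLead π ω h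
    exact (reward_fst_eq_zero (active_stateAt π ω t) (π.feasible _) (by omega)).le

lemma exists_adopt (h : ∀ t, ∃ n, π.act (stateAt π ω (t + n)) ≠ Action.wait)
    (hlead : ∀ᶠ t in atTop, blockLead ω t < 0) : ∃ t, π.act (stateAt π ω t) = Action.adopt := by
  by_contra! hne
  obtain ⟨N, hN⟩ := eventually_atTop.1 hlead
  obtain ⟨n, hn⟩ := h N
  have h1 := lead_le_blockLead π ω (t := N + n) fun s _ => hne s
  have h2 := hN (N + n) (by omega)
  rcases eq_adopt_or_eq_wait (π.feasible (stateAt π ω (N + n))) (by omega) with h3 | h3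
  · exact hne _ h3
  · exact hn h3

lemma stateAt_congr {ω ω' : ℕ → Creator} {t : ℕ} (h : ∀ s ≤ t, ω s = ω' s) :
    stateAt π ω t = stateAt π ω' t := by
  induction t with
  | zero => simp [stateAt, h 0 le_rfl]
  | succ t ih => simp [stateAt, ih fun s hs => h s (by omega), h (t + 1) le_rfl]

lemma rewardAt_congr {ω ω' : ℕ → Creator} {t : ℕ} (h : ∀ s ≤ t + 1, ω s = ω' s) :
    rewardAt π ω t = rewardAt π ω' t := by
  have hx : stateAt π ω t = stateAt π ω' t := stateAt_congr π fun s hs => h s (by omega)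
  simp [rewardAt, hx, h (t + 1) le_rfl]

/-! ### Decomposition of a path into cycles -/

/-- The time of the first `adopt`; it is `0` if there is none. -/
noncomputable def adoptTime : ℕ := sInf {t | π.act (stateAt π ω t) = Action.adopt}

/-- The blocks created after the first `adopt`. -/
noncomputable def afterAdopt : ℕ → Creator := fun n => ω (n + (adoptTime π ω + 1))

variable {π ω}

lemma act_adoptTime (h : ∃ t, π.act (stateAt π ω t) = Action.adopt) :
    π.act (stateAt π ω (adoptTime π ω)) = Action.adopt := Nat.sInf_mem h

lemma act_ne_adopt {s : ℕ} (h : s < adoptTime π ω) : π.act (stateAt π ω s) ≠ Action.adopt :=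
  Nat.notMem_of_lt_sInf h

lemma adoptTime_eq {n : ℕ} (h : π.act (stateAt π ω n) = Action.adopt)
    (h' : ∀ s < n, π.act (stateAt π ω s) ≠ Action.adopt) : adoptTime π ω = n := by
  refine le_antisymm (Nat.sInf_le h) ?_
  by_contra! hlt
  exact h' _ hlt (act_adoptTime ⟨n, h⟩)

/-- The state after `adopt` depends only on the next block, so the game starts afresh on the shifted
sequence. -/
lemma stateAt_afterAdopt (h : ∃ t, π.act (stateAt π ω t) = Action.adopt) (n : ℕ) :
    stateAt π (afterAdopt π ω) n = stateAt π ω (n + (adoptTime π ω + 1)) := by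
  induction n with
  | zero =>
    rw [zero_add]
    simp [stateAt, act_adoptTime h, next, afterAdopt]
  | succ n ih =>
    rw [show n + 1 + (adoptTime π ω + 1) = n + (adoptTime π ω + 1) + 1 by ring]
    simp only [stateAt, ih]
    congr 1
    simp only [afterAdopt]
    congr 1
    ring

lemma rewardAt_afterAdopt (h : ∃ t, π.act (stateAt π ω t) = Action.adopt) (n : ℕ) :
    rewardAt π (afterAdopt π ω) n = rewardAt π ω (n + (adoptTime π ω + 1)) := by
  simp only [rewardAt, stateAt_afterAdopt h]
  congr 1
  simp only [afterAdopt]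
  congr 1
  ring

variable (π ω)

/-- The accepted blocks of the attacker up to the first `adopt`. -/
noncomputable def attackerCycle : ℕ := attackerTotal π ω (adoptTime π ω)

/-- The accepted blocks of the honest network up to and including the first `adopt`. -/
noncomputable def honestCycle : ℕ :=
  honestTotal π ω (adoptTime π ω) + (stateAt π ω (adoptTime π ω)).h

/-- The duration of the first `k` cycles, each of which ends with `adopt`. -/
noncomputable def cyclesEnd (k : ℕ) : ℕ :=
  ∑ i ∈ Finset.range k, (adoptTime π ((afterAdopt π)^[i] ω) + 1)

variable {π ω}

lemma cyclesEnd_succ (k : ℕ) :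
    cyclesEnd π ω (k + 1) = cyclesEnd π (afterAdopt π ω) k + (adoptTime π ω + 1) := by
  simp [cyclesEnd, Finset.sum_range_succ']

lemma attackerTotal_cyclesEnd
    (h : ∀ i, ∃ t, π.act (stateAt π ((afterAdopt π)^[i] ω) t) = Action.adopt) (k : ℕ) :
    attackerTotal π ω (cyclesEnd π ω k) =
      ∑ i ∈ Finset.range k, attackerCycle π ((afterAdopt π)^[i] ω) := by
  -- The first cycle is split off, not the last: the remaining ones are the cycles of `afterAdopt π
  -- ω`.
  induction k generalizing ω with
  | zero => simp [cyclesEnd, attackerTotal]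
  | succ k ih =>
    have h0 : ∃ t, π.act (stateAt π ω t) = Action.adopt := h 0
    rw [cyclesEnd_succ, Finset.sum_range_succ', add_comm (cyclesEnd _ _ _), attackerTotal,
      Finset.sum_range_add]
    simp only [Function.iterate_succ_apply, ← ih fun i => h (i + 1)]
    rw [add_comm]
    congr 1
    · simp only [attackerTotal, rewardAt_afterAdopt h0, add_comm]
    · rw [Finset.sum_range_succ]
      simp [attackerCycle, attackerTotal, rewardAt, act_adoptTime h0, reward]

lemma honestTotal_cyclesEnd
    (h : ∀ i, ∃ t, π.act (stateAt π ((afterAdopt π)^[i] ω) t) = Action.adopt) (k : ℕ) :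
    honestTotal π ω (cyclesEnd π ω k) =
      ∑ i ∈ Finset.range k, honestCycle π ((afterAdopt π)^[i] ω) := by
  induction k generalizing ω with
  | zero => simp [cyclesEnd, honestTotal]
  | succ k ih =>
    have h0 : ∃ t, π.act (stateAt π ω t) = Action.adopt := h 0
    rw [cyclesEnd_succ, Finset.sum_range_succ', add_comm (cyclesEnd _ _ _), honestTotal,
      Finset.sum_range_add]
    simp only [Function.iterate_succ_apply, ← ih fun i => h (i + 1)]
    rw [add_comm]
    congr 1
    · simp only [honestTotal, rewardAt_afterAdopt h0, add_comm]
    · rw [Finset.sum_range_succ]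
      simp [honestCycle, honestTotal, rewardAt, act_adoptTime h0, reward]

/-- At the end of a cycle no public block is pending, since `adopt` pays for all `h` of them; the
error term of `le_totals_add` is absorbed. -/
lemma sum_honestCount_cyclesEnd_le
    (h : ∀ i, ∃ t, π.act (stateAt π ((afterAdopt π)^[i] ω) t) = Action.adopt) (k : ℕ) :
    ∑ s ∈ Finset.range (cyclesEnd π ω k), honestCount (ω s) ≤
      attackerTotal π ω (cyclesEnd π ω k) + honestTotal π ω (cyclesEnd π ω k) := by
  rw [attackerTotal_cyclesEnd h, honestTotal_cyclesEnd h]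
  induction k generalizing ω with
  | zero => simp [cyclesEnd]
  | succ k ih =>
    have h1 := ih fun i => h (i + 1)
    have h2 := le_totals_add π ω (adoptTime π ω)
    rw [cyclesEnd_succ, Finset.sum_range_succ', add_comm (cyclesEnd _ _ _),
      Finset.sum_range_succ', Finset.sum_range_add]
    simp only [Function.iterate_succ_apply, Function.iterate_zero, id]
    simp only [afterAdopt, attackerCycle, honestCycle, add_comm (adoptTime π ω + 1)] at h1 h2 ⊢
    omega

lemma le_cyclesEnd (k : ℕ) : k ≤ cyclesEnd π ω k := by
  simpa [cyclesEnd] using Finset.card_nsmul_le_sum (Finset.range k)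
    (fun i => adoptTime π ((afterAdopt π)^[i] ω) + 1) 1 fun i _ => by omega

lemma attackerCycle_le : attackerCycle π ω ≤ adoptTime π ω + 1 := by
  have h1 := attackerTotal_add_le π ω (adoptTime π ω)
  have h2 := sum_attackerCount_le ω (adoptTime π ω + 1)
  rw [attackerCycle]
  omega

lemma honestCycle_le : honestCycle π ω ≤ adoptTime π ω + 1 :=
  (honestTotal_add_le π ω (adoptTime π ω)).trans (sum_honestCount_le ω _)

end Totals

/-! ### The independent block sequence and its shifts -/

instance : Finite Creator :=
  Finite.of_injective (β := Fin 3)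
    (fun | .attacker => 0 | .honestReached => 1 | .honestOther => 2)
    (by rintro (_ | _ | _) (_ | _ | _) <;> simp)

instance : DiscreteMeasurableSpace Creator := ⟨fun _ => trivial⟩

lemma isProbabilityMeasure_blockLaw {α γ : ℝ} (hα0 : 0 ≤ α) (hα : α < 1 / 2) (hγ0 : 0 ≤ γ)
    (hγ1 : γ ≤ 1) : IsProbabilityMeasure (blockLaw α γ) := by
  constructor
  have h1 : 0 ≤ γ * (1 - α) := mul_nonneg hγ0 (by linarith)
  have h2 : 0 ≤ (1 - γ) * (1 - α) := mul_nonneg (by linarith) (by linarith)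
  simp only [blockLaw, Measure.add_apply, Measure.smul_apply, measure_univ, smul_eq_mul, mul_one]
  rw [← ENNReal.ofReal_add hα0 h1, ← ENNReal.ofReal_add (by linarith) h2, ← ENNReal.ofReal_one]
  congr 1
  ring

/-- Such a function factors through a finite discrete space; the padding value is arbitrary. The
σ-algebra of the first coordinates is kept because independence needs it. -/
lemma measurable_of_congr {β : Type*} [MeasurableSpace β] {f : (ℕ → Creator) → β} (n : ℕ)
    (hf : ∀ ω ω', (∀ s ≤ n, ω s = ω' s) → f ω = f ω') :
    Measurable[⨆ i ∈ Set.Iic n, MeasurableSpace.comap (fun ω : ℕ → Creator => ω i) inferInstance]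
      f := by
  let g : (Finset.Iic n → Creator) → β := fun x =>
    f fun i => if h : i ∈ Finset.Iic n then x ⟨i, h⟩ else Creator.attacker
  have hfg : f = g ∘ fun ω i => ω i := by
    funext ω
    refine hf _ _ fun s hs => ?_
    simp [hs]
  rw [hfg]
  refine (Measurable.of_discrete (f := g)).comp ?_
  refine @measurable_pi_lambda _ _ _ (_) _ _ fun i => ?_
  refine Measurable.of_comap_le ?_
  exact le_iSup₂_of_le i.1 (Finset.mem_Iic.1 i.2) le_rfl

lemma measurable_of_congr' {β : Type*} [MeasurableSpace β] {f : (ℕ → Creator) → β} (n : ℕ)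
    (hf : ∀ ω ω', (∀ s ≤ n, ω s = ω' s) → f ω = f ω') : Measurable f :=
  (measurable_of_congr n hf).mono
    (iSup₂_le fun i _ => (measurable_pi_apply i).comap_le) le_rfl

section Shift

variable (ν : Measure Creator) [IsProbabilityMeasure ν]

lemma measurePreserving_shift (n : ℕ) :
    MeasurePreserving (fun (ω : ℕ → Creator) k => ω (k + n))
      (Measure.infinitePi fun _ : ℕ => ν) (Measure.infinitePi fun _ : ℕ => ν) :=
  ⟨by fun_prop, Measure.map_infinitePi_infinitePi_of_inj (add_left_injective n)⟩

lemma measure_inter_shift {n : ℕ} {A : Set (ℕ → Creator)}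
    (hA : ∀ ω ω', (∀ s ≤ n, ω s = ω' s) → (ω ∈ A ↔ ω' ∈ A)) {C : Set (ℕ → Creator)}
    (hC : MeasurableSet C) :
    Measure.infinitePi (fun _ : ℕ => ν) (A ∩ (fun ω k => ω (k + (n + 1))) ⁻¹' C) =
      Measure.infinitePi (fun _ : ℕ => ν) A * Measure.infinitePi (fun _ : ℕ => ν) C := by
  have hind : iIndepFun (fun (i : ℕ) (ω : ℕ → Creator) => ω i)
      (Measure.infinitePi fun _ : ℕ => ν) :=
    iIndepFun_infinitePi (P := fun _ : ℕ => ν) (X := fun _ b => b) (fun _ => measurable_id)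
  have h := indep_iSup_of_disjoint (fun i => (measurable_pi_apply i).comap_le) hind.iIndep
    (S := Set.Iic n) (T := Set.Ioi n) (by
      rw [Set.disjoint_left]; intro i hi hi'; simp at hi hi'; omega)
  rw [Indep_iff] at h
  rw [h _ _ ?_ ?_, (measurePreserving_shift ν (n + 1)).measure_preimage hC.nullMeasurableSet]
  · have := measurable_of_congr (f := fun ω => ω ∈ A) n fun ω ω' h => propext (hA ω ω' h)
    exact @measurableSet_setOfPred _ (_) _ |>.2 this
  · refine @measurable_pi_lambda _ _ _ (_) _ _ (fun k => ?_) _ hC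
    refine Measurable.of_comap_le ?_
    exact le_iSup₂_of_le (f := fun (i : ℕ) (_ : i ∈ Set.Ioi n) => MeasurableSpace.comap
      (fun f : ℕ → Creator => f i) inferInstance) (k + (n + 1)) (by simp; omega) le_rfl

end Shift

/-! ### Regeneration at the first adoption -/

section StrongMarkov

variable (π : Policy)

lemma measurableSet_act (t : ℕ) (u : Action) :
    MeasurableSet {ω : ℕ → Creator | π.act (stateAt π ω t) = u} :=
  measurableSet_setOfPred.2 <| measurable_of_congr' t fun ω ω' h => by rw [stateAt_congr π h]

lemma measurable_adoptTime : Measurable (adoptTime π) := by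
  refine measurable_to_countable' fun n => ?_
  -- Since `sInf ∅ = 0`, the level set of `0` also contains the paths that never adopt.
  have h : adoptTime π ⁻¹' {n} = {ω | (π.act (stateAt π ω n) = Action.adopt ∧
      ∀ s < n, ¬ π.act (stateAt π ω s) = Action.adopt) ∨
      (n = 0 ∧ ∀ t, ¬ π.act (stateAt π ω t) = Action.adopt)} := by
    ext ω
    simp only [Set.mem_preimage, Set.mem_singleton_iff, Set.mem_ofPred_eq]
    constructor
    · rintro rfl
      by_cases h : ∃ t, π.act (stateAt π ω t) = Action.adopt
      · exact Or.inl ⟨act_adoptTime h, fun s hs => act_ne_adopt hs⟩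
      · push Not at h
        refine Or.inr ⟨?_, h⟩
        simp [adoptTime, h]
    · rintro (⟨h1, h2⟩ | ⟨rfl, h⟩)
      · exact adoptTime_eq h1 h2
      · simp [adoptTime, h]
  rw [h]
  have hm := fun t => measurableSet_setOfPred.1 (measurableSet_act π t Action.adopt)
  exact measurableSet_setOfPred.2 <| ((hm n).and <| Measurable.forall fun s =>
    measurable_const.imp (hm s).not).or
      (measurable_const.and <| Measurable.forall fun s => (hm s).not)

lemma measurable_comp_adoptTime {β : Type*} [MeasurableSpace β] {F : ℕ → (ℕ → Creator) → β}
    (hF : ∀ n, Measurable (F n)) : Measurable fun ω => F (adoptTime π ω) ω :=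
  (measurable_from_prod_countable_right (f := fun p : ℕ × (ℕ → Creator) => F p.1 p.2) hF).comp
    ((measurable_adoptTime π).prodMk measurable_id)

lemma measurable_afterAdopt : Measurable (afterAdopt π) :=
  measurable_comp_adoptTime π (F := fun n ω k => ω (k + (n + 1))) fun n => by fun_prop

section Regeneration

variable {π} {ν : Measure Creator} [IsProbabilityMeasure ν]

/-- Strong Markov property: where the first `adopt` is at time `n`, an event determined by the
blocks up to `n`, `afterAdopt` is the fixed shift by `n + 1`. Independence holds on each piece, and
the pieces are summed over `n`. -/
lemma measure_inter_afterAdopt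
    (hadopt : ∀ᵐ ω ∂Measure.infinitePi (fun _ : ℕ => ν),
      ∃ t, π.act (stateAt π ω t) = Action.adopt)
    {F : ℕ → (ℕ → Creator) → ℝ}
    (hF : ∀ n ω ω', (∀ s ≤ n, ω s = ω' s) → F n ω = F n ω') (B : Set ℝ)
    {C : Set (ℕ → Creator)} (hC : MeasurableSet C) :
    Measure.infinitePi (fun _ : ℕ => ν)
        ((fun ω => F (adoptTime π ω) ω) ⁻¹' B ∩ afterAdopt π ⁻¹' C) =
      Measure.infinitePi (fun _ : ℕ => ν) ((fun ω => F (adoptTime π ω) ω) ⁻¹' B) *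
        Measure.infinitePi (fun _ : ℕ => ν) C := by
  set μ := Measure.infinitePi (fun _ : ℕ => ν)
  let A : ℕ → Set (ℕ → Creator) := fun n => {ω | (π.act (stateAt π ω n) = Action.adopt ∧
    ∀ s < n, π.act (stateAt π ω s) ≠ Action.adopt) ∧ F n ω ∈ B}
  have hAc : ∀ n ω ω', (∀ s ≤ n, ω s = ω' s) → (ω ∈ A n ↔ ω' ∈ A n) := by
    intro n ω ω' h
    have h1 : ∀ s ≤ n, stateAt π ω s = stateAt π ω' s := fun s hs =>
      stateAt_congr π fun r hr => h r (hr.trans hs)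
    simp only [A, Set.mem_ofPred_eq, hF n ω ω' h, h1 n le_rfl]
    refine and_congr_left fun _ => and_congr_right fun _ => ?_
    exact forall₂_congr fun s hs => by rw [h1 s hs.le]
  have hAm : ∀ n, MeasurableSet (A n) := fun n =>
    measurableSet_setOfPred.2 (measurable_of_congr' n fun ω ω' h => propext (hAc n ω ω' h))
  have hAt : ∀ n, ∀ ω ∈ A n, adoptTime π ω = n := fun n ω h => adoptTime_eq h.1.1 h.1.2
  have hdisj : Pairwise (Function.onFun Disjoint A) := fun m n hmn =>
    Set.disjoint_left.2 fun ω h1 h2 => hmn ((hAt m ω h1).symm.trans (hAt n ω h2))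
  have hA : (fun ω => F (adoptTime π ω) ω) ⁻¹' B =ᵐ[μ] ⋃ n, A n := by
    filter_upwards [hadopt] with ω hω
    refine propext (Iff.trans ?_ Set.mem_iUnion.symm)
    constructor
    · exact fun h => ⟨adoptTime π ω, ⟨act_adoptTime hω, fun s hs => act_ne_adopt hs⟩, h⟩
    · rintro ⟨n, hn⟩
      have := hn.2
      rwa [← hAt n ω hn] at this
  have hAC : (⋃ n, A n) ∩ afterAdopt π ⁻¹' C =
      ⋃ n, (A n ∩ (fun ω k => ω (k + (n + 1))) ⁻¹' C) := by
    ext ω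
    simp only [Set.mem_inter_iff, Set.mem_iUnion, Set.mem_preimage]
    constructor
    · rintro ⟨⟨n, hn⟩, h⟩
      refine ⟨n, hn, ?_⟩
      rwa [← hAt n ω hn]
    · rintro ⟨n, hn, h⟩
      refine ⟨⟨n, hn⟩, ?_⟩
      rwa [← hAt n ω hn] at h
  have hAC' := hA.inter (ae_eq_refl (afterAdopt π ⁻¹' C))
  rw [hAC] at hAC'
  rw [measure_congr hAC', measure_congr hA, measure_iUnion, measure_iUnion hdisj hAm,
    ← ENNReal.tsum_mul_right]
  · exact tsum_congr fun n => measure_inter_shift ν (hAc n) hC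
  · exact fun m n hmn => (hdisj hmn).mono Set.inter_subset_left Set.inter_subset_left
  · exact fun n => (hAm n).inter ((measurePreserving_shift ν (n + 1)).measurable hC)

lemma measurePreserving_afterAdopt
    (hadopt : ∀ᵐ ω ∂Measure.infinitePi (fun _ : ℕ => ν),
      ∃ t, π.act (stateAt π ω t) = Action.adopt) :
    MeasurePreserving (afterAdopt π) (Measure.infinitePi fun _ : ℕ => ν)
      (Measure.infinitePi fun _ : ℕ => ν) := by
  refine ⟨measurable_afterAdopt π, Measure.ext fun C hC => ?_⟩
  rw [Measure.map_apply (measurable_afterAdopt π) hC]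
  simpa using measure_inter_afterAdopt hadopt (F := fun _ _ => 0) (fun _ _ _ _ => rfl)
    Set.univ hC

lemma indepFun_afterAdopt
    (hadopt : ∀ᵐ ω ∂Measure.infinitePi (fun _ : ℕ => ν),
      ∃ t, π.act (stateAt π ω t) = Action.adopt)
    {F : ℕ → (ℕ → Creator) → ℝ}
    (hF : ∀ n ω ω', (∀ s ≤ n, ω s = ω' s) → F n ω = F n ω') :
    IndepFun (fun ω => F (adoptTime π ω) ω) (afterAdopt π)
      (Measure.infinitePi fun _ : ℕ => ν) := by
  refine indepFun_iff_measure_inter_preimage_eq_mul.2 fun B C _ hC => ?_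
  rw [measure_inter_afterAdopt hadopt hF B hC,
    (measurePreserving_afterAdopt hadopt).measure_preimage hC.nullMeasurableSet]

end Regeneration

end StrongMarkov

/-- The strong law of large numbers along the iterates of a measure preserving map which forgets
the given function. -/
lemma tendsto_sum_iterate {Ω : Type*} [MeasurableSpace Ω] {μ : Measure Ω} {θ : Ω → Ω}
    (hθ : MeasurePreserving θ μ μ) {f : Ω → ℝ} (hf : Measurable f) (hint : Integrable f μ)
    (hind : IndepFun f θ μ) :
    ∀ᵐ ω ∂μ, Tendsto (fun n : ℕ => (∑ i ∈ Finset.range n, f (θ^[i] ω)) / n) atTop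
      (𝓝 (∫ ω, f ω ∂μ)) := by
  -- Pairwise independence is enough for the strong law used here. It follows by pulling back the
  -- independence of `f` and `θ` along `θ^[i]`.
  have key : ∀ i j, i < j → IndepFun (fun ω => f (θ^[i] ω)) (fun ω => f (θ^[j] ω)) μ := by
    intro i j hij
    obtain ⟨k, rfl⟩ := Nat.exists_eq_add_of_lt hij
    have h0 : IndepFun f (fun ω => f (θ^[k] (θ ω))) μ :=
      hind.comp measurable_id (hf.comp (hθ.measurable.iterate k))
    have hj : ∀ ω, θ^[i + k + 1] ω = θ^[k] (θ (θ^[i] ω)) := fun ω => by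
      rw [show i + k + 1 = (k + 1) + i by ring, Function.iterate_add_apply,
        Function.iterate_succ_apply]
    have hmeas : Measurable fun ω => f (θ^[k] (θ ω)) :=
      hf.comp ((hθ.measurable.iterate k).comp hθ.measurable)
    rw [indepFun_iff_measure_inter_preimage_eq_mul] at h0 ⊢
    intro B C hB hC
    have h1 := h0 B C hB hC
    have hi := hθ.iterate i
    rw [← hi.measure_preimage (hf hB).nullMeasurableSet,
      ← hi.measure_preimage (hmeas hC).nullMeasurableSet,
      ← hi.measure_preimage ((hf hB).inter (hmeas hC)).nullMeasurableSet] at h1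
    simp only [hj]
    exact h1
  refine strong_law_ae_real (fun i ω => f (θ^[i] ω)) hint ?_ fun i => ?_
  · intro i j hij
    rcases lt_or_gt_of_ne hij with h | h
    · exact key i j h
    · exact (key j i h).symm
  · have h := (hθ.iterate i).measurable
    refine ⟨(hf.comp h).aemeasurable, hf.aemeasurable, ?_⟩
    rw [show (fun ω => f (θ^[i] ω)) = f ∘ θ^[i] from rfl, ← Measure.map_map hf h,
      (hθ.iterate i).map_eq]
    rfl

/-! ### Exponential tail of the lead -/

/-- The exponential weight of a block which dominates the drift of the lead. -/
noncomputable def leadWeight (α : ℝ) : Creator → ℝ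
  | .attacker => 2 * (1 - α)
  | _ => (2 * (1 - α))⁻¹

section Tail

variable {α γ : ℝ}

lemma lintegral_blockLaw (f : Creator → ℝ≥0∞) :
    ∫⁻ b, f b ∂blockLaw α γ = ENNReal.ofReal α * f .attacker +
      ENNReal.ofReal (γ * (1 - α)) * f .honestReached +
      ENNReal.ofReal ((1 - γ) * (1 - α)) * f .honestOther := by
  simp [blockLaw, lintegral_add_measure, lintegral_smul_measure]

/-- With `z = 2 (1 - α) > 1` the mean weight is `α z + (1 - α) / z`, and the second term is exactly
`1/2`. This choice also covers `α = 0`. -/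
lemma lintegral_leadWeight (hα0 : 0 ≤ α) (hα : α < 1 / 2) (hγ0 : 0 ≤ γ)
    (hγ1 : γ ≤ 1) :
    ∫⁻ b, ENNReal.ofReal (leadWeight α b) ∂blockLaw α γ =
      ENNReal.ofReal (2 * α * (1 - α) + 1 / 2) := by
  have h1 : 0 < 1 - α := by linarith
  have h2 : 0 ≤ 1 - γ := by linarith
  rw [lintegral_blockLaw]
  simp only [leadWeight]
  rw [← ENNReal.ofReal_mul hα0, ← ENNReal.ofReal_mul (by positivity),
    ← ENNReal.ofReal_mul (by positivity), ← ENNReal.ofReal_add (by positivity) (by positivity),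
    ← ENNReal.ofReal_add (by positivity) (by positivity)]
  congr 1
  field_simp
  ring

lemma one_le_prod_leadWeight {α : ℝ} (hα : α < 1 / 2) {ω : ℕ → Creator} {t : ℕ}
    (h : 0 ≤ blockLead ω t) :
    1 ≤ ∏ s ∈ Finset.range (t + 1), leadWeight α (ω s) := by
  have h1 : 1 < 2 * (1 - α) := by linarith
  have h2 : ∏ s ∈ Finset.range (t + 1), leadWeight α (ω s) = (2 * (1 - α)) ^ blockLead ω t := by
    have hb : ∀ b, leadWeight α b =
        (2 * (1 - α)) ^ ((attackerCount b : ℤ) - honestCount b) := by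
      rintro (_ | _ | _) <;> simp [leadWeight, attackerCount, honestCount]
    simp only [hb, blockLead]
    generalize t + 1 = n
    induction n with
    | zero => simp
    | succ n ih => rw [Finset.prod_range_succ, Finset.sum_range_succ, ih, zpow_add₀ (by linarith)]
  rw [h2]
  exact one_le_zpow₀ h1.le h

/-- Chernoff bound: Markov's inequality for the product of the independent weights, which is at
least `1` on the event. -/
lemma measure_blockLead_nonneg_le (hα0 : 0 ≤ α) (hα : α < 1 / 2) (hγ0 : 0 ≤ γ)
    (hγ1 : γ ≤ 1) (t : ℕ) :
    blocksLaw α γ {ω | 0 ≤ blockLead ω t} ≤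
      ENNReal.ofReal (2 * α * (1 - α) + 1 / 2) ^ (t + 1) := by
  have := isProbabilityMeasure_blockLaw hα0 hα hγ0 hγ1
  have hpos : ∀ b, 0 ≤ leadWeight α b := by
    have h1 : 0 < 1 - α := by linarith
    rintro (_ | _ | _) <;> simp only [leadWeight] <;> positivity
  have hind : iIndepFun (fun (i : ℕ) (ω : ℕ → Creator) => ENNReal.ofReal (leadWeight α (ω i)))
      (blocksLaw α γ) :=
    iIndepFun_infinitePi (P := fun _ : ℕ => blockLaw α γ)
      (X := fun _ b => ENNReal.ofReal (leadWeight α b)) (fun _ => Measurable.of_discrete)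
  have hmeas : ∀ i : ℕ, Measurable fun ω : ℕ → Creator => ENNReal.ofReal (leadWeight α (ω i)) :=
    fun i => (Measurable.of_discrete (f := fun b => ENNReal.ofReal (leadWeight α b))).comp
      (measurable_pi_apply i)
  have hE := lintegral_prod_eq_prod_lintegral_of_indepFun (Finset.range (t + 1)) _ hind hmeas
  have hi : ∀ i : ℕ, ∫⁻ ω : ℕ → Creator, ENNReal.ofReal (leadWeight α (ω i)) ∂blocksLaw α γ =
      ENNReal.ofReal (2 * α * (1 - α) + 1 / 2) := fun i => by
    rw [← lintegral_leadWeight hα0 hα hγ0 hγ1]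
    exact (measurePreserving_eval_infinitePi (fun _ : ℕ => blockLaw α γ) i).lintegral_comp
      (f := fun b => ENNReal.ofReal (leadWeight α b)) Measurable.of_discrete
  simp only [hi, Finset.prod_const, Finset.card_range] at hE
  rw [← hE]
  have hM := mul_meas_ge_le_lintegral₀ (μ := blocksLaw α γ)
    (Finset.measurable_prod (Finset.range (t + 1)) fun i _ => hmeas i).aemeasurable 1
  rw [one_mul] at hM
  refine (measure_mono fun ω hω => ?_).trans hM
  show 1 ≤ ∏ i ∈ Finset.range (t + 1), ENNReal.ofReal (leadWeight α (ω i))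
  rw [← ENNReal.ofReal_prod_of_nonneg fun i _ => hpos _, ← ENNReal.ofReal_one]
  exact ENNReal.ofReal_le_ofReal (one_le_prod_leadWeight hα hω)

lemma tsum_measure_blockLead_lt_top (hα0 : 0 ≤ α) (hα : α < 1 / 2) (hγ0 : 0 ≤ γ)
    (hγ1 : γ ≤ 1) :
    ∑' t : ℕ, ((t : ℝ≥0∞) + 1) * blocksLaw α γ {ω | 0 ≤ blockLead ω t} < ∞ := by
  have hb := measure_blockLead_nonneg_le hα0 hα hγ0 hγ1
  have hq0 : 0 ≤ 2 * α * (1 - α) + 1 / 2 := by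
    have : 0 ≤ 1 - α := by linarith
    positivity
  -- The gap to `1` is `(1 - 2 α)² / 2`.
  have hq1 : 2 * α * (1 - α) + 1 / 2 < 1 := by nlinarith
  generalize 2 * α * (1 - α) + 1 / 2 = q at hb hq0 hq1
  refine lt_of_le_of_lt (b := ∑' t : ℕ, ((t : ℝ≥0∞) + 1) * ENNReal.ofReal q ^ (t + 1))
    (ENNReal.tsum_le_tsum fun t => by gcongr; exact hb t) ?_
  have hs : Summable fun t : ℕ => ((t : ℝ) + 1) * q ^ (t + 1) := by
    have h1 : Summable fun n : ℕ => (n : ℝ) ^ 1 * q ^ n :=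
      summable_pow_mul_geometric_of_norm_lt_one 1 (by rwa [Real.norm_of_nonneg hq0])
    have h2 := (summable_nat_add_iff (f := fun n : ℕ => (n : ℝ) ^ 1 * q ^ n) 1).2 h1
    simpa using h2
  have h := hs.tsum_ofReal_lt_top
  refine lt_of_le_of_lt (le_of_eq (tsum_congr fun t => ?_)) h
  rw [ENNReal.ofReal_mul (by positivity), ENNReal.ofReal_pow hq0,
    ENNReal.ofReal_add (by positivity) zero_le_one, ENNReal.ofReal_natCast, ENNReal.ofReal_one]

/-- Borel–Cantelli. -/
lemma ae_eventually_blockLead_neg (hα0 : 0 ≤ α) (hα : α < 1 / 2) (hγ0 : 0 ≤ γ)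
    (hγ1 : γ ≤ 1) :
    ∀ᵐ ω ∂blocksLaw α γ, ∀ᶠ t in atTop, blockLead ω t < 0 := by
  have h : ∑' t : ℕ, blocksLaw α γ {ω | 0 ≤ blockLead ω t} ≠ ∞ := by
    refine ne_top_of_le_ne_top (tsum_measure_blockLead_lt_top hα0 hα hγ0 hγ1).ne
      (ENNReal.tsum_le_tsum fun t => ?_)
    exact le_mul_of_one_le_left' (by simp)
  filter_upwards [ae_eventually_notMem h] with ω hω
  simpa using hω

end Tail

/-! ### Integrability and measurability of cycle revenues -/

section Cycles

variable {π : Policy}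

lemma measurable_nextActionDelay (t : ℕ) :
    Measurable fun ω => nextActionDelay π ω t := by
  refine Measurable.iInf fun n => ?_
  refine measurable_of_congr' (t + n) fun ω ω' h => ?_
  rw [stateAt_congr π h]

lemma Admissible.ae_exists_ne_wait {α γ : ℝ} (h : Admissible α γ π) :
    ∀ᵐ ω ∂blocksLaw α γ, ∀ t, ∃ n, π.act (stateAt π ω (t + n)) ≠ Action.wait := by
  refine ae_all_iff.2 fun t => ?_
  filter_upwards [ae_lt_top (measurable_nextActionDelay t) (h t).ne] with ω hω
  by_contra! hw
  simp [nextActionDelay, hw] at hω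

lemma Admissible.ae_exists_adopt {α γ : ℝ} (hα0 : 0 ≤ α) (hα : α < 1 / 2) (hγ0 : 0 ≤ γ)
    (hγ1 : γ ≤ 1) (h : Admissible α γ π) :
    ∀ᵐ ω ∂blocksLaw α γ, ∃ t, π.act (stateAt π ω t) = Action.adopt := by
  filter_upwards [h.ae_exists_ne_wait, ae_eventually_blockLead_neg hα0 hα hγ0 hγ1] with ω h1 h2
  exact exists_adopt π ω h1 h2

/-- The reward at time `t` looks at block `t + 1`, so the rewards before `n` need no block beyond
`n`. Thus a cycle's revenue does not see the block that restarts the game. -/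
lemma attackerTotal_congr {ω ω' : ℕ → Creator} {n : ℕ} (h : ∀ s ≤ n, ω s = ω' s) :
    attackerTotal π ω n = attackerTotal π ω' n :=
  Finset.sum_congr rfl fun t ht => by
    rw [rewardAt_congr π fun s hs => h s (by have := Finset.mem_range.1 ht; omega)]

lemma honestTotal_congr {ω ω' : ℕ → Creator} {n : ℕ} (h : ∀ s ≤ n, ω s = ω' s) :
    honestTotal π ω n = honestTotal π ω' n :=
  Finset.sum_congr rfl fun t ht => by
    rw [rewardAt_congr π fun s hs => h s (by have := Finset.mem_range.1 ht; omega)]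

/-- The accepted blocks of the attacker in a cycle have finite expectation, even if the cycle
itself has infinite expected duration. -/
lemma lintegral_attackerCycle_lt_top {α γ : ℝ} (hα0 : 0 ≤ α) (hα : α < 1 / 2) (hγ0 : 0 ≤ γ)
    (hγ1 : γ ≤ 1) : ∫⁻ ω, (attackerCycle π ω : ℝ≥0∞) ∂blocksLaw α γ < ∞ := by
  have hm : ∀ t : ℕ, MeasurableSet {ω : ℕ → Creator | 0 ≤ blockLead ω t} := fun t =>
    measurableSet_setOfPred.2 <| measurable_of_congr' t fun ω ω' h => by
      have : blockLead ω t = blockLead ω' t :=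
        Finset.sum_congr rfl fun s hs => by rw [h s (by have := Finset.mem_range.1 hs; omega)]
      rw [this]
  refine lt_of_le_of_lt ?_ (tsum_measure_blockLead_lt_top hα0 hα hγ0 hγ1)
  calc ∫⁻ ω, (attackerCycle π ω : ℝ≥0∞) ∂blocksLaw α γ
      ≤ ∫⁻ ω, ∑' t : ℕ, Set.indicator {ω | 0 ≤ blockLead ω t} (fun _ => (t : ℝ≥0∞) + 1) ω
          ∂blocksLaw α γ := by
        refine lintegral_mono fun ω => ?_
        -- All summands precede the first `adopt`, so `rewardAt_fst_le` bounds each one; the random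
        -- range is then enlarged to all times.
        refine le_trans ?_ (ENNReal.sum_le_tsum (Finset.range (adoptTime π ω)))
        rw [attackerCycle, attackerTotal, Nat.cast_sum]
        refine Finset.sum_le_sum fun t ht => ?_
        have h1 := rewardAt_fst_le π ω (t := t) fun s hs =>
          act_ne_adopt (hs.trans (Finset.mem_range.1 ht))
        rw [Set.indicator_apply]
        refine (Nat.cast_le.2 h1).trans (le_of_eq ?_)
        simp only [Set.mem_ofPred_eq]
        split_ifs <;> simp
    _ = ∑' t : ℕ, ((t : ℝ≥0∞) + 1) * blocksLaw α γ {ω | 0 ≤ blockLead ω t} := by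
        rw [lintegral_tsum fun t => (measurable_const.indicator (hm t)).aemeasurable]
        exact tsum_congr fun t => lintegral_indicator_const (hm t) _

lemma measurable_attackerCycle : Measurable fun ω => (attackerCycle π ω : ℝ) :=
  measurable_comp_adoptTime π (F := fun n ω => (attackerTotal π ω n : ℝ)) fun n =>
    measurable_of_congr' n fun ω ω' h => by rw [attackerTotal_congr h]

lemma measurable_honestCycle : Measurable fun ω => (honestCycle π ω : ℝ) :=
  measurable_comp_adoptTime π
    (F := fun n ω => ((honestTotal π ω n + (stateAt π ω n).h : ℕ) : ℝ)) fun n =>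
    measurable_of_congr' n fun ω ω' h => by rw [honestTotal_congr h, stateAt_congr π h]

lemma measurable_cycleLength : Measurable fun ω => (adoptTime π ω : ℝ) + 1 :=
  measurable_comp_adoptTime π (F := fun n _ => (n : ℝ) + 1) fun _ => measurable_const

lemma integrable_attackerCycle {α γ : ℝ} (hα0 : 0 ≤ α) (hα : α < 1 / 2) (hγ0 : 0 ≤ γ)
    (hγ1 : γ ≤ 1) : Integrable (fun ω => (attackerCycle π ω : ℝ)) (blocksLaw α γ) := by
  refine ⟨measurable_attackerCycle.aestronglyMeasurable, ?_⟩
  rw [hasFiniteIntegral_iff_ofReal (ae_of_all _ fun _ => by positivity)]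
  simpa using lintegral_attackerCycle_lt_top (π := π) hα0 hα hγ0 hγ1

end Cycles

/-! ### Limits of real sequences -/

section Sequences

/-- The growth rate of a monotone sequence which is known along a sequence of renewal times. -/
lemma tendsto_div_of_renewal {u : ℕ → ℝ} (hu : Monotone u) {σ : ℕ → ℕ} (hσ : Tendsto σ atTop atTop)
    {m P : ℝ} (hm : 0 < m) (hσm : Tendsto (fun k : ℕ => (σ k : ℝ) / k) atTop (𝓝 m))
    (hP : Tendsto (fun k : ℕ => u (σ k) / k) atTop (𝓝 P)) :
    Tendsto (fun T : ℕ => u T / T) atTop (𝓝 (P / m)) := by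
  refine tendsto_div_of_monotone_of_exists_subseq_tendsto_div u _ hu fun a ha => ⟨σ, ?_, hσ, ?_⟩
  -- Consecutive renewal times have ratio tending to `1`, so monotonicity controls `u` between them.
  · have h1 : Tendsto (fun k : ℕ => (σ (k + 1) : ℝ) / (k + 1 : ℕ) * (((k + 1 : ℕ) : ℝ) / k)) atTop
        (𝓝 (m * 1)) := by
      refine ((tendsto_add_atTop_iff_nat 1).2 hσm).mul ?_
      have := (tendsto_one_div_atTop_nhds_zero_nat (𝕜 := ℝ)).const_add 1
      rw [add_zero] at this
      refine this.congr' ?_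
      filter_upwards [eventually_gt_atTop 0] with k hk
      have : (k : ℝ) ≠ 0 := by positivity
      push_cast
      field_simp
    have h2 : m * 1 < a * m := by nlinarith
    filter_upwards [h1.eventually_lt (hσm.const_mul a) h2, eventually_gt_atTop 0] with k hk hk0
    have hk' : (0 : ℝ) < k := by positivity
    have : (σ (k + 1) : ℝ) / k < a * σ k / k := by
      rw [div_mul_div_cancel₀ (by positivity)] at hk
      rwa [mul_div_assoc]
    exact ((div_lt_div_iff_of_pos_right hk').1 this).le
  · refine (hP.div hσm hm.ne').congr' ?_
    filter_upwards [eventually_gt_atTop 0] with k hk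
    have : (k : ℝ) ≠ 0 := by positivity
    simp only [Pi.div_apply]
    field_simp

lemma sum_Icc_eq (f : ℕ → ℝ) (T : ℕ) :
    ∑ t ∈ Finset.Icc 1 T, f t = ∑ t ∈ Finset.range (T + 1), f t - f 0 := by
  rw [Finset.sum_range_succ', add_sub_cancel_right, Finset.range_eq_Ico,
    Finset.sum_Ico_add' f 0 T 1]
  rfl

lemma tendsto_sum_Icc_div {f : ℕ → ℝ} {L : ℝ}
    (h : Tendsto (fun T : ℕ => (∑ t ∈ Finset.range T, f t) / T) atTop (𝓝 L)) :
    Tendsto (fun T : ℕ => (∑ t ∈ Finset.Icc 1 T, f t) / T) atTop (𝓝 L) := by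
  have h1 := (tendsto_add_atTop_iff_nat 1).2 h
  have h2 := (tendsto_one_div_atTop_nhds_zero_nat (𝕜 := ℝ))
  have h3 := (h1.mul (h2.const_add 1)).sub (h2.const_mul (f 0))
  simp only [add_zero, mul_one, mul_zero, sub_zero] at h3
  refine h3.congr' ?_
  filter_upwards [eventually_gt_atTop 0] with T hT
  rw [sum_Icc_eq]
  have : (T : ℝ) ≠ 0 := by positivity
  push_cast
  field_simp

/-- A lower limit needs a lower bound at all times but an upper bound only along a subsequence, so
cycle ends suffice for the latter. -/
lemma liminf_eq_of_subseq {g l u : ℕ → ℝ} {s : ℕ → ℕ} {L : ℝ} (hl : Tendsto l atTop (𝓝 L))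
    (hlg : ∀ᶠ T in atTop, l T ≤ g T) (hs : Tendsto s atTop atTop) (hu : Tendsto u atTop (𝓝 L))
    (hgu : ∀ᶠ k in atTop, g (s k) ≤ u k) : liminf g atTop = L := by
  have hb : IsBoundedUnder (· ≥ ·) atTop g := by
    refine ⟨L - 1, ?_⟩
    rw [eventually_map]
    filter_upwards [hlg, hl.eventually_const_lt (sub_one_lt L)] with T h1 h2
    exact h2.le.trans h1
  have hfreq : ∀ ε > 0, ∃ᶠ T in atTop, g T ≤ L + ε := fun ε hε =>
    hs.frequently <| Eventually.frequently <| by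
      filter_upwards [hgu, hu.eventually_lt_const (lt_add_of_pos_right L hε)] with k h1 h2
      exact h1.trans h2.le
  refine le_antisymm (le_of_forall_pos_le_add fun ε hε =>
    liminf_le_of_frequently_le (hfreq ε hε) hb) ?_
  refine le_of_forall_pos_sub_le fun ε hε => ?_
  refine le_liminf_of_le ?_ ?_
  · exact IsCoboundedUnder.of_frequently_le (hfreq 1 one_pos)
  · filter_upwards [hlg, hl.eventually_const_lt (sub_lt_self L hε)] with T h1 h2
    exact h2.le.trans h1

end Sequences

/-! ### Lower limits along a single path -/

section Paths

variable {π : Policy} {ω : ℕ → Creator}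

lemma monotone_attackerTotal : Monotone fun T => (attackerTotal π ω T : ℝ) :=
  fun _ _ h => Nat.cast_le.2 <| Finset.sum_le_sum_of_subset (Finset.range_mono h)

lemma monotone_honestTotal : Monotone fun T => (honestTotal π ω T : ℝ) :=
  fun _ _ h => Nat.cast_le.2 <| Finset.sum_le_sum_of_subset (Finset.range_mono h)

lemma sum_Icc_attacker (T : ℕ) : ∑ t ∈ Finset.Icc 1 T, ((rewardAt π ω t).1 : ℝ) =
    attackerTotal π ω (T + 1) - (rewardAt π ω 0).1 := by
  rw [sum_Icc_eq fun t => ((rewardAt π ω t).1 : ℝ)]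
  simp [attackerTotal]

lemma sum_Icc_honest (T : ℕ) : ∑ t ∈ Finset.Icc 1 T, ((rewardAt π ω t).2 : ℝ) =
    honestTotal π ω (T + 1) - (rewardAt π ω 0).2 := by
  rw [sum_Icc_eq fun t => ((rewardAt π ω t).2 : ℝ)]
  simp [honestTotal]

lemma sum_Icc_linearReward (ρ : ℝ) (T : ℕ) :
    ∑ t ∈ Finset.Icc 1 T, linearReward ρ (rewardAt π ω t) =
      (1 - ρ) * ∑ t ∈ Finset.Icc 1 T, ((rewardAt π ω t).1 : ℝ) -
        ρ * ∑ t ∈ Finset.Icc 1 T, ((rewardAt π ω t).2 : ℝ) := by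
  simp [linearReward, Finset.sum_sub_distrib, Finset.mul_sum]

lemma liminf_value_of_tendsto {p q : ℝ}
    (hp : Tendsto (fun T : ℕ => (attackerTotal π ω T : ℝ) / T) atTop (𝓝 p))
    (hq : Tendsto (fun T : ℕ => (honestTotal π ω T : ℝ) / T) atTop (𝓝 q)) (ρ : ℝ) :
    liminf (fun T : ℕ => (1 / (T : ℝ)) *
      ∑ t ∈ Finset.Icc 1 T, linearReward ρ (rewardAt π ω t)) atTop = (1 - ρ) * p - ρ * q := by
  have hp' := tendsto_sum_Icc_div (f := fun t => ((rewardAt π ω t).1 : ℝ)) (L := p)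
    (by simpa [attackerTotal] using hp)
  have hq' := tendsto_sum_Icc_div (f := fun t => ((rewardAt π ω t).2 : ℝ)) (L := q)
    (by simpa [honestTotal] using hq)
  refine Tendsto.liminf_eq (((hp'.const_mul (1 - ρ)).sub (hq'.const_mul ρ)).congr fun T => ?_)
  rw [sum_Icc_linearReward]
  ring

lemma liminf_ratio_of_tendsto {p q : ℝ}
    (hp : Tendsto (fun T : ℕ => (attackerTotal π ω T : ℝ) / T) atTop (𝓝 p))
    (hq : Tendsto (fun T : ℕ => (honestTotal π ω T : ℝ) / T) atTop (𝓝 q)) (hpq : p + q ≠ 0) :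
    liminf (fun T : ℕ => (∑ t ∈ Finset.Icc 1 T, ((rewardAt π ω t).1 : ℝ)) /
      (∑ t ∈ Finset.Icc 1 T, (((rewardAt π ω t).1 : ℝ) + ((rewardAt π ω t).2 : ℝ)))) atTop =
      p / (p + q) := by
  have hp' := tendsto_sum_Icc_div (f := fun t => ((rewardAt π ω t).1 : ℝ)) (L := p)
    (by simpa [attackerTotal] using hp)
  have hq' := tendsto_sum_Icc_div (f := fun t => ((rewardAt π ω t).2 : ℝ)) (L := q)
    (by simpa [honestTotal] using hq)
  refine Tendsto.liminf_eq ((hp'.div (hp'.add hq') hpq).congr' ?_)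
  filter_upwards [eventually_gt_atTop 0] with T hT
  have : (T : ℝ) ≠ 0 := by positivity
  simp only [Pi.div_apply]
  rw [Finset.sum_add_distrib, ← add_div, div_div_div_cancel_right₀ this]

/-- The number of honest blocks among the first `T` blocks. -/
def honestBlocks (ω : ℕ → Creator) (T : ℕ) : ℕ := ∑ s ∈ Finset.range T, honestCount (ω s)

lemma honestTotal_succ_le (T : ℕ) : honestTotal π ω (T + 1) ≤ honestBlocks ω T + 2 := by
  have h := honestTotal_add_le π ω (T + 1)
  have h1 := attackerCount_add_honestCount (ω T)
  have h2 := attackerCount_add_honestCount (ω (T + 1))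
  rw [Finset.sum_range_succ, Finset.sum_range_succ] at h
  simp only [honestBlocks]
  omega

/-- The honest network is never paid more than its own blocks, which bounds the mean from below.
Along `σ` the attacker's total is negligible, so nearly all of `honestBlocks` must have been paid to
the honest network. -/
lemma liminf_value_of_subseq {σ : ℕ → ℕ} {c : ℝ} (hσ : Tendsto σ atTop atTop)
    (hN : Tendsto (fun T : ℕ => (honestBlocks ω T : ℝ) / T) atTop (𝓝 c))
    (hA : Tendsto (fun k : ℕ => (attackerTotal π ω (σ k) : ℝ) / σ k) atTop (𝓝 0))
    (hle : ∀ k, honestBlocks ω (σ k) ≤ attackerTotal π ω (σ k) + honestTotal π ω (σ k))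
    {ρ : ℝ} (hρ0 : 0 ≤ ρ) (hρ1 : ρ ≤ 1) :
    liminf (fun T : ℕ => (1 / (T : ℝ)) *
      ∑ t ∈ Finset.Icc 1 T, linearReward ρ (rewardAt π ω t)) atTop = -ρ * c := by
  have hinv := tendsto_one_div_atTop_nhds_zero_nat (𝕜 := ℝ)
  have hl : Tendsto (fun T : ℕ => -ρ * ((honestBlocks ω T : ℝ) / T + 2 * (1 / (T : ℝ)))) atTop
      (𝓝 (-ρ * c)) := by
    simpa using (hN.add (hinv.const_mul 2)).const_mul (-ρ)
  -- Totals over `σ k` transitions correspond to sums over `Icc 1 (σ k - 1)`. The factor `1 + 1 / (σ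
  -- k - 1)` below changes the normalization accordingly, and the coefficient `2` leaves slack.
  have hs : Tendsto (fun k => σ k - 1) atTop atTop := (tendsto_sub_atTop_nat 1).comp hσ
  have hu : Tendsto (fun k => (2 * ((attackerTotal π ω (σ k) : ℝ) / σ k) -
      ρ * ((honestBlocks ω (σ k) : ℝ) / σ k) + (rewardAt π ω 0).2 * (1 / (σ k : ℝ))) *
      (1 + 1 / ((σ k - 1 : ℕ) : ℝ))) atTop (𝓝 (-ρ * c)) := by
    have := (((hA.const_mul 2).sub ((hN.comp hσ).const_mul ρ)).add
      ((hinv.comp hσ).const_mul ((rewardAt π ω 0).2 : ℝ))).mul ((hinv.comp hs).const_add 1)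
    simpa using this
  refine liminf_eq_of_subseq hl ?_ hs hu ?_
  · filter_upwards [eventually_gt_atTop 0] with T hT
    have h1 : ((rewardAt π ω 0).1 : ℝ) ≤ attackerTotal π ω (T + 1) := by
      have := monotone_attackerTotal (π := π) (ω := ω) (show 1 ≤ T + 1 by omega)
      simpa [attackerTotal] using this
    have h2 : (honestTotal π ω (T + 1) : ℝ) ≤ honestBlocks ω T + 2 := by
      exact_mod_cast honestTotal_succ_le T
    have h3 : (0 : ℝ) ≤ (rewardAt π ω 0).2 := by positivity
    rw [sum_Icc_linearReward, sum_Icc_attacker, sum_Icc_honest]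
    have h4 : -ρ * ((honestBlocks ω T : ℝ) / T + 2 * (1 / (T : ℝ))) =
        1 / (T : ℝ) * (-ρ * (honestBlocks ω T + 2)) := by ring
    rw [h4]
    gcongr
    nlinarith
  · filter_upwards [hσ.eventually_ge_atTop 2] with k hk
    obtain ⟨n, hn⟩ : ∃ n, σ k = n + 1 := ⟨σ k - 1, by omega⟩
    have hle' : (honestBlocks ω (n + 1) : ℝ) ≤
        attackerTotal π ω (n + 1) + honestTotal π ω (n + 1) := by
      exact_mod_cast hn ▸ hle k
    have hn0 : (0 : ℝ) < n := by
      have : 0 < n := by omega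
      positivity
    have h1 : (0 : ℝ) ≤ (rewardAt π ω 0).1 := by positivity
    have h2 : (0 : ℝ) ≤ (rewardAt π ω 0).2 := by positivity
    have h3 : (0 : ℝ) ≤ attackerTotal π ω (n + 1) := by positivity
    simp only [hn, Nat.add_sub_cancel]
    rw [sum_Icc_linearReward, sum_Icc_attacker, sum_Icc_honest]
    have h4 : (2 * ((attackerTotal π ω (n + 1) : ℝ) / ((n + 1 : ℕ) : ℝ)) -
        ρ * ((honestBlocks ω (n + 1) : ℝ) / ((n + 1 : ℕ) : ℝ)) +
        (rewardAt π ω 0).2 * (1 / ((n + 1 : ℕ) : ℝ))) * (1 + 1 / (n : ℝ)) =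
        1 / (n : ℝ) * (2 * attackerTotal π ω (n + 1) - ρ * honestBlocks ω (n + 1) +
          (rewardAt π ω 0).2) := by
      push_cast
      field_simp
    rw [h4]
    gcongr
    nlinarith [mul_le_mul_of_nonneg_left hle' hρ0, mul_nonneg hρ0 h3, mul_nonneg hρ0 h2,
      mul_nonneg (sub_nonneg.2 hρ1) h1, mul_nonneg (sub_nonneg.2 hρ1) h3,
      mul_nonneg (sub_nonneg.2 hρ1) h2]

lemma liminf_ratio_of_subseq {σ : ℕ → ℕ} {c : ℝ} (hc : 0 < c) (hσ : Tendsto σ atTop atTop)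
    (hN : Tendsto (fun T : ℕ => (honestBlocks ω T : ℝ) / T) atTop (𝓝 c))
    (hA : Tendsto (fun k : ℕ => (attackerTotal π ω (σ k) : ℝ) / σ k) atTop (𝓝 0))
    (hle : ∀ k, honestBlocks ω (σ k) ≤ attackerTotal π ω (σ k) + honestTotal π ω (σ k)) :
    liminf (fun T : ℕ => (∑ t ∈ Finset.Icc 1 T, ((rewardAt π ω t).1 : ℝ)) /
      (∑ t ∈ Finset.Icc 1 T, (((rewardAt π ω t).1 : ℝ) + ((rewardAt π ω t).2 : ℝ)))) atTop = 0 := by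
  have hinv := tendsto_one_div_atTop_nhds_zero_nat (𝕜 := ℝ)
  have hs : Tendsto (fun k => σ k - 1) atTop atTop := (tendsto_sub_atTop_nat 1).comp hσ
  set C : ℝ := (rewardAt π ω 0).1 + (rewardAt π ω 0).2 with hC
  have hd : Tendsto (fun k => ((honestBlocks ω (σ k) : ℝ) / σ k) - C * (1 / (σ k : ℝ))) atTop
      (𝓝 c) := by
    simpa using (hN.comp hσ).sub ((hinv.comp hσ).const_mul C)
  have hu : Tendsto (fun k => ((attackerTotal π ω (σ k) : ℝ) / σ k) /
      (((honestBlocks ω (σ k) : ℝ) / σ k) - C * (1 / (σ k : ℝ)))) atTop (𝓝 0) := by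
    rw [← zero_div c]
    exact hA.div hd hc.ne'
  refine liminf_eq_of_subseq tendsto_const_nhds (Eventually.of_forall fun T => by positivity)
    hs hu ?_
  filter_upwards [hσ.eventually_ge_atTop 1, hd.eventually_const_lt hc] with k hk hpos
  obtain ⟨n, hn⟩ : ∃ n, σ k = n + 1 := ⟨σ k - 1, by omega⟩
  have hle' : (honestBlocks ω (n + 1) : ℝ) ≤
      attackerTotal π ω (n + 1) + honestTotal π ω (n + 1) := by
    exact_mod_cast hn ▸ hle k
  have hn0 : (0 : ℝ) < ((n + 1 : ℕ) : ℝ) := by positivity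
  have h1 : (0 : ℝ) ≤ (rewardAt π ω 0).1 := by positivity
  have h3 : (0 : ℝ) ≤ attackerTotal π ω (n + 1) := by positivity
  simp only [hn, Nat.add_sub_cancel] at hpos ⊢
  rw [Finset.sum_add_distrib, sum_Icc_attacker, sum_Icc_honest]
  have h5 : (honestBlocks ω (n + 1) : ℝ) / ((n + 1 : ℕ) : ℝ) - C * (1 / ((n + 1 : ℕ) : ℝ)) =
      (honestBlocks ω (n + 1) - C) / ((n + 1 : ℕ) : ℝ) := by ring
  rw [h5] at hpos ⊢
  rw [div_div_div_cancel_right₀ hn0.ne']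
  have h6 : 0 < (honestBlocks ω (n + 1) : ℝ) - C := (div_pos_iff_of_pos_right hn0).1 hpos
  gcongr <;> linarith

end Paths

/-- Along the iterates of a measure preserving map which forgets the given nonnegative function,
the averages tend to infinity if the function is not integrable. -/
lemma tendsto_sum_iterate_atTop {Ω : Type*} [MeasurableSpace Ω] {μ : Measure Ω}
    [IsProbabilityMeasure μ] {θ : Ω → Ω} (hθ : MeasurePreserving θ μ μ) {f : Ω → ℝ}
    (hf : Measurable f) (hf0 : ∀ ω, 0 ≤ f ω) (hint : ¬ Integrable f μ) (hind : IndepFun f θ μ) :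
    ∀ᵐ ω ∂μ, Tendsto (fun n : ℕ => (∑ i ∈ Finset.range n, f (θ^[i] ω)) / n) atTop atTop := by
  have hm : ∀ M : ℕ, Measurable fun ω => min (f ω) M := fun M => hf.min measurable_const
  have hi : ∀ M : ℕ, Integrable (fun ω => min (f ω) M) μ := fun M =>
    Integrable.of_bound (hm M).aestronglyMeasurable (M : ℝ) (ae_of_all _ fun ω => by
      rw [Real.norm_of_nonneg (le_min (hf0 ω) (by positivity))]
      exact min_le_right _ _)
  -- By monotone convergence, bounded truncated means would make `f` integrable; the strong law is
  -- applied to the truncations.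
  have hbig : ∀ K : ℝ, ∃ M : ℕ, K < ∫ ω, min (f ω) M ∂μ := by
    intro K
    by_contra! hK
    refine hint ⟨hf.aestronglyMeasurable, ?_⟩
    rw [hasFiniteIntegral_iff_ofReal (ae_of_all _ hf0)]
    have h1 : ∀ ω, ENNReal.ofReal (f ω) = ⨆ M : ℕ, ENNReal.ofReal (min (f ω) M) := by
      intro ω
      refine le_antisymm ?_ (iSup_le fun M => ENNReal.ofReal_le_ofReal (min_le_left _ _))
      obtain ⟨M, hM⟩ := exists_nat_ge (f ω)
      exact le_iSup_of_le M (by rw [min_eq_left hM])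
    simp only [h1]
    rw [lintegral_iSup (fun M => (hm M).ennreal_ofReal) fun M M' h ω =>
      ENNReal.ofReal_le_ofReal (min_le_min_left _ (Nat.cast_le.2 h))]
    refine lt_of_le_of_lt (iSup_le fun M => ?_) (ENNReal.ofReal_lt_top (r := K))
    rw [← ofReal_integral_eq_lintegral_ofReal (hi M)
      (ae_of_all _ fun ω => le_min (hf0 ω) (by positivity))]
    exact ENNReal.ofReal_le_ofReal (hK M)
  have hlim : ∀ᵐ ω ∂μ, ∀ M : ℕ, Tendsto
      (fun n : ℕ => (∑ i ∈ Finset.range n, min (f (θ^[i] ω)) M) / n) atTop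
      (𝓝 (∫ ω, min (f ω) M ∂μ)) := ae_all_iff.2 fun M =>
    tendsto_sum_iterate hθ (hm M) (hi M)
      (hind.comp (φ := fun x : ℝ => min x M) (by fun_prop) measurable_id)
  filter_upwards [hlim] with ω hω
  refine tendsto_atTop.2 fun K => ?_
  obtain ⟨M, hM⟩ := hbig K
  filter_upwards [(hω M).eventually_const_lt hM] with n hn
  refine hn.le.trans ?_
  gcongr
  exact min_le_left _ _

/-! ### Revenue rates of admissible policies -/

section Rates

variable {α γ : ℝ} {π : Policy}

lemma ae_tendsto_honestBlocks (hα0 : 0 ≤ α) (hα : α < 1 / 2) (hγ0 : 0 ≤ γ) (hγ1 : γ ≤ 1) :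
    ∀ᵐ ω ∂blocksLaw α γ, Tendsto (fun T : ℕ => (honestBlocks ω T : ℝ) / T) atTop (𝓝 (1 - α)) := by
  have := isProbabilityMeasure_blockLaw hα0 hα hγ0 hγ1
  have hmp := fun i => measurePreserving_eval_infinitePi (fun _ : ℕ => blockLaw α γ) i
  have hind : iIndepFun (fun (i : ℕ) (ω : ℕ → Creator) => (honestCount (ω i) : ℝ))
      (blocksLaw α γ) :=
    iIndepFun_infinitePi (P := fun _ : ℕ => blockLaw α γ)
      (X := fun _ b => (honestCount b : ℝ)) (fun _ => Measurable.of_discrete)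
  have hid : ∀ i, IdentDistrib (fun ω : ℕ → Creator => (honestCount (ω i) : ℝ))
      (fun ω => (honestCount (ω 0) : ℝ)) (blocksLaw α γ) (blocksLaw α γ) := fun i =>
    IdentDistrib.comp (u := fun b => (honestCount b : ℝ))
      ⟨(measurable_pi_apply i).aemeasurable, (measurable_pi_apply 0).aemeasurable,
        (hmp i).map_eq.trans (hmp 0).map_eq.symm⟩ Measurable.of_discrete
  have hmeas : Measurable fun ω : ℕ → Creator => (honestCount (ω 0) : ℝ) :=
    (Measurable.of_discrete (f := fun b => (honestCount b : ℝ))).comp (measurable_pi_apply 0)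
  have hE : ∫ ω : ℕ → Creator, (honestCount (ω 0) : ℝ) ∂blocksLaw α γ = 1 - α := by
    have h1 : 0 ≤ γ * (1 - α) := mul_nonneg hγ0 (by linarith)
    have h2 : 0 ≤ (1 - γ) * (1 - α) := mul_nonneg (by linarith) (by linarith)
    have h3 : ∫⁻ ω : ℕ → Creator, ENNReal.ofReal (honestCount (ω 0) : ℝ) ∂blocksLaw α γ =
        ∫⁻ b, ENNReal.ofReal (honestCount b : ℝ) ∂blockLaw α γ :=
      (hmp 0).lintegral_comp (f := fun b => ENNReal.ofReal (honestCount b : ℝ))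
        Measurable.of_discrete
    rw [integral_eq_lintegral_of_nonneg_ae (ae_of_all _ fun _ => Nat.cast_nonneg _)
      hmeas.aestronglyMeasurable, h3, lintegral_blockLaw]
    simp only [honestCount, Nat.cast_zero, Nat.cast_one, ENNReal.ofReal_zero, ENNReal.ofReal_one,
      mul_zero, mul_one, zero_add]
    rw [← ENNReal.ofReal_add h1 h2, ENNReal.toReal_ofReal (by linarith)]
    ring
  have hint : Integrable (fun ω : ℕ → Creator => (honestCount (ω 0) : ℝ)) (blocksLaw α γ) := by
    have : IsProbabilityMeasure (blocksLaw α γ) := by unfold blocksLaw; infer_instance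
    refine Integrable.of_bound hmeas.aestronglyMeasurable 1 (ae_of_all _ fun ω => ?_)
    cases ω 0 <;> simp [honestCount]
  have h := strong_law_ae_real (fun (i : ℕ) (ω : ℕ → Creator) => (honestCount (ω i) : ℝ)) hint
    (fun i j hij => hind.indepFun hij) hid
  rw [hE] at h
  simpa [honestBlocks] using h

/-- The long run behaviour of an admissible policy is that of two revenue rates. -/
theorem Admissible.exists_rates (hα0 : 0 ≤ α) (hα : α < 1 / 2) (hγ0 : 0 ≤ γ) (hγ1 : γ ≤ 1)
    (h : Admissible α γ π) :
    ∃ p q : ℝ, p ≤ 1 ∧ 0 ≤ q ∧ 1 - α ≤ p + q ∧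
      (∀ ρ ∈ Set.Icc (0 : ℝ) 1, value α γ ρ π = (1 - ρ) * p - ρ * q) ∧
      REV α γ π = p / (p + q) := by
  have := isProbabilityMeasure_blockLaw hα0 hα hγ0 hγ1
  have hprob : IsProbabilityMeasure (blocksLaw α γ) := by unfold blocksLaw; infer_instance
  have hadopt := h.ae_exists_adopt hα0 hα hγ0 hγ1
  have hθ : MeasurePreserving (afterAdopt π) (blocksLaw α γ) (blocksLaw α γ) :=
    measurePreserving_afterAdopt hadopt
  have hall : ∀ᵐ ω ∂blocksLaw α γ, ∀ i, ∃ t,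
      π.act (stateAt π ((afterAdopt π)^[i] ω) t) = Action.adopt :=
    ae_all_iff.2 fun i => (hθ.iterate i).quasiMeasurePreserving.ae hadopt
  have hN := ae_tendsto_honestBlocks hα0 hα hγ0 hγ1
  have hindA : IndepFun (fun ω => (attackerCycle π ω : ℝ)) (afterAdopt π) (blocksLaw α γ) :=
    indepFun_afterAdopt hadopt (F := fun n ω => (attackerTotal π ω n : ℝ)) fun n ω ω' h => by
      rw [attackerTotal_congr h]
  have hindH : IndepFun (fun ω => (honestCycle π ω : ℝ)) (afterAdopt π) (blocksLaw α γ) :=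
    indepFun_afterAdopt hadopt
      (F := fun n ω => ((honestTotal π ω n + (stateAt π ω n).h : ℕ) : ℝ)) fun n ω ω' h => by
      rw [honestTotal_congr h, stateAt_congr π h]
  have hindL : IndepFun (fun ω => (adoptTime π ω : ℝ) + 1) (afterAdopt π) (blocksLaw α γ) :=
    indepFun_afterAdopt hadopt (F := fun n _ => (n : ℝ) + 1) fun _ _ _ _ => rfl
  have hA := tendsto_sum_iterate hθ measurable_attackerCycle
    (integrable_attackerCycle hα0 hα hγ0 hγ1) hindA
  have hσ : ∀ ω, Tendsto (cyclesEnd π ω) atTop atTop := fun ω =>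
    tendsto_atTop_mono le_cyclesEnd tendsto_id
  have hle : ∀ᵐ ω ∂blocksLaw α γ, ∀ k, honestBlocks ω (cyclesEnd π ω k) ≤
      attackerTotal π ω (cyclesEnd π ω k) + honestTotal π ω (cyclesEnd π ω k) := by
    filter_upwards [hall] with ω hω k using sum_honestCount_cyclesEnd_le hω k
  have hAk : ∀ᵐ ω ∂blocksLaw α γ,
      Tendsto (fun k : ℕ => (attackerTotal π ω (cyclesEnd π ω k) : ℝ) / k) atTop
        (𝓝 (∫ ω, (attackerCycle π ω : ℝ) ∂blocksLaw α γ)) := by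
    filter_upwards [hall, hA] with ω hω h1
    simpa [attackerTotal_cyclesEnd hω] using h1
  have hconst : ∀ {F : (ℕ → Creator) → ℝ} {L : ℝ}, (∀ᵐ ω ∂blocksLaw α γ, F ω = L) →
      ∫ ω, F ω ∂blocksLaw α γ = L := fun hF => by
    rw [integral_congr_ae hF]; simp
  by_cases hint : Integrable (fun ω => (adoptTime π ω : ℝ) + 1) (blocksLaw α γ)
  · have hL := tendsto_sum_iterate hθ measurable_cycleLength hint hindL
    have hintH : Integrable (fun ω => (honestCycle π ω : ℝ)) (blocksLaw α γ) := by
      refine hint.mono' measurable_honestCycle.aestronglyMeasurable (ae_of_all _ fun ω => ?_)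
      rw [Real.norm_of_nonneg (by positivity)]
      exact_mod_cast honestCycle_le
    have hH := tendsto_sum_iterate hθ measurable_honestCycle hintH hindH
    set m := ∫ ω, ((adoptTime π ω : ℝ) + 1) ∂blocksLaw α γ
    set P := ∫ ω, (attackerCycle π ω : ℝ) ∂blocksLaw α γ
    set Q := ∫ ω, (honestCycle π ω : ℝ) ∂blocksLaw α γ
    have hm : 0 < m := by
      have : ∫ _, (1 : ℝ) ∂blocksLaw α γ ≤ m :=
        integral_mono (integrable_const 1) hint fun ω => by simp
      simp only [integral_const, probReal_univ, smul_eq_mul, mul_one] at this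
      linarith
    have hQ : 0 ≤ Q := integral_nonneg fun ω => by positivity
    have hPm : P ≤ m := integral_mono (integrable_attackerCycle hα0 hα hγ0 hγ1) hint fun ω => by
      simpa using (Nat.cast_le (α := ℝ)).2 (attackerCycle_le (π := π) (ω := ω))
    have hrate : ∀ᵐ ω ∂blocksLaw α γ,
        Tendsto (fun T : ℕ => (attackerTotal π ω T : ℝ) / T) atTop (𝓝 (P / m)) ∧
        Tendsto (fun T : ℕ => (honestTotal π ω T : ℝ) / T) atTop (𝓝 (Q / m)) := by
      filter_upwards [hall, hAk, hH, hL] with ω hω h1 h2 h3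
      have h3' : Tendsto (fun k : ℕ => (cyclesEnd π ω k : ℝ) / k) atTop (𝓝 m) := by
        simpa [cyclesEnd] using h3
      have h2' : Tendsto (fun k : ℕ => (honestTotal π ω (cyclesEnd π ω k) : ℝ) / k) atTop
          (𝓝 Q) := by
        simpa [honestTotal_cyclesEnd hω] using h2
      exact ⟨tendsto_div_of_renewal monotone_attackerTotal (hσ ω) hm h3' h1,
        tendsto_div_of_renewal monotone_honestTotal (hσ ω) hm h3' h2'⟩
    -- The limits are deterministic, so the pathwise inequality at cycle ends is needed on one good
    -- path only.
    have hsum : 1 - α ≤ P / m + Q / m := by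
      obtain ⟨ω, ⟨h1, h2⟩, h3, h4⟩ := (hrate.and (hN.and hle)).exists
      refine le_of_tendsto_of_tendsto' (h3.comp (hσ ω)) ((h1.add h2).comp (hσ ω)) fun k => ?_
      simp only [Function.comp_apply]
      rw [← add_div]
      gcongr
      exact_mod_cast h4 k
    refine ⟨P / m, Q / m, (div_le_one hm).2 hPm, by positivity, hsum, fun ρ _ => ?_, ?_⟩
    · refine hconst ?_
      filter_upwards [hrate] with ω hω using liminf_value_of_tendsto hω.1 hω.2 ρ
    · refine hconst ?_
      filter_upwards [hrate] with ω hω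
      exact liminf_ratio_of_tendsto hω.1 hω.2 (by linarith)
  · have hL := tendsto_sum_iterate_atTop hθ measurable_cycleLength (fun ω => by positivity)
      hint hindL
    have hAσ : ∀ᵐ ω ∂blocksLaw α γ, Tendsto
        (fun k : ℕ => (attackerTotal π ω (cyclesEnd π ω k) : ℝ) / cyclesEnd π ω k) atTop
        (𝓝 0) := by
      filter_upwards [hAk, hL] with ω h1 h2
      have h2' : Tendsto (fun k : ℕ => (cyclesEnd π ω k : ℝ) / k) atTop atTop := by
        simpa [cyclesEnd] using h2
      refine (h1.div_atTop h2').congr' ?_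
      filter_upwards [eventually_gt_atTop 0] with k hk
      rw [div_div_div_cancel_right₀ (by positivity)]
    -- These need not be limits of the pathwise rates; they only reproduce the two lower limits.
    refine ⟨0, 1 - α, zero_le_one, by linarith, by linarith, fun ρ hρ => ?_, ?_⟩
    · refine hconst ?_
      filter_upwards [hN, hAσ, hle] with ω h1 h2 h3
      rw [liminf_value_of_subseq (hσ ω) h1 h2 h3 hρ.1 hρ.2]
      ring
    · refine hconst ?_
      filter_upwards [hN, hAσ, hle] with ω h1 h2 h3
      rw [liminf_ratio_of_subseq (by linarith) (hσ ω) h1 h2 h3, zero_div]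

/-- The policy that always adopts the honest chain. -/
def adoptPolicy : Policy := ⟨fun _ => .adopt, fun _ => trivial⟩

lemma admissible_adoptPolicy : Admissible α γ adoptPolicy := fun t => by
  have h : ∀ ω, nextActionDelay adoptPolicy ω t = 0 := fun ω =>
    le_antisymm ((iInf₂_le 0 (by simp [adoptPolicy])).trans (by simp)) zero_le
  simp [h]

/-- The real supremum dominates its set only if that set is bounded above; `p ≤ 1` and `q ≥ 0` give
the bound `1`. -/
lemma value_le_optimalValue (hα0 : 0 ≤ α) (hα : α < 1 / 2) (hγ0 : 0 ≤ γ) (hγ1 : γ ≤ 1)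
    {ρ : ℝ} (hρ : ρ ∈ Set.Icc (0 : ℝ) 1) (h : Admissible α γ π) :
    value α γ ρ π ≤ optimalValue α γ ρ := by
  refine le_csSup ⟨1, ?_⟩ ⟨π, h, rfl⟩
  rintro _ ⟨π', h', rfl⟩
  obtain ⟨p, q, hp, hq, -, hv, -⟩ := h'.exists_rates hα0 hα hγ0 hγ1
  rw [hv ρ hρ]
  nlinarith [mul_nonneg hρ.1 hq, mul_le_mul_of_nonneg_left hp (sub_nonneg.2 hρ.2), hρ.1]

end Rates

end SelfishMining

theorem proposition2 (α γ : ℝ) (hα0 : 0 ≤ α) (hα : α < 1 / 2) (hγ0 : 0 ≤ γ) (hγ1 : γ ≤ 1) :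
    (∀ ρ ∈ Set.Icc (0 : ℝ) 1, SelfishMining.optimalValue α γ ρ = 0 →
      ∀ π : SelfishMining.Policy, SelfishMining.Admissible α γ π →
        SelfishMining.value α γ ρ π = 0 →
          (∀ π' : SelfishMining.Policy, SelfishMining.Admissible α γ π' →
            SelfishMining.REV α γ π' ≤ SelfishMining.REV α γ π) ∧
          ρ = SelfishMining.REV α γ π) ∧
    StrictAntiOn (fun ρ : ℝ => SelfishMining.optimalValue α γ ρ) (Set.Icc 0 1) := by
  constructor
  · intro ρ hρ hopt π hπ hval
    obtain ⟨p, q, -, -, hpq, hv, hR⟩ := hπ.exists_rates hα0 hα hγ0 hγ1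
    have hpos : 0 < p + q := by linarith
    have hρR : ρ = SelfishMining.REV α γ π := by
      rw [hv ρ hρ] at hval
      rw [hR, eq_div_iff hpos.ne']
      linarith
    refine ⟨fun π' hπ' => ?_, hρR⟩
    obtain ⟨p', q', -, -, hpq', hv', hR'⟩ := hπ'.exists_rates hα0 hα hγ0 hγ1
    have hpos' : 0 < p' + q' := by linarith
    have hle := SelfishMining.value_le_optimalValue hα0 hα hγ0 hγ1 hρ hπ'
    rw [hopt, hv' ρ hρ] at hle
    rw [← hρR, hR', div_le_iff₀ hpos']
    linarith
  · intro ρ hρ ρ' hρ' hlt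
    -- Passing from `ρ` to `ρ'` costs each policy `(ρ' - ρ) (p + q)`. The bound `p + q ≥ 1 - α` is
    -- uniform, so the strict gap survives the supremum.
    have hle : SelfishMining.optimalValue α γ ρ' ≤
        SelfishMining.optimalValue α γ ρ - (ρ' - ρ) * (1 - α) := by
      refine csSup_le ⟨_, SelfishMining.adoptPolicy, SelfishMining.admissible_adoptPolicy, rfl⟩ ?_
      rintro _ ⟨π, hπ, rfl⟩
      obtain ⟨p, q, -, -, hpq, hv, -⟩ := hπ.exists_rates hα0 hα hγ0 hγ1
      have h1 := SelfishMining.value_le_optimalValue hα0 hα hγ0 hγ1 hρ hπ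
      rw [hv ρ hρ] at h1
      rw [hv ρ' hρ']
      nlinarith [mul_le_mul_of_nonneg_left hpq (sub_nonneg.2 hlt.le)]
    have h2 : 0 < (ρ' - ρ) * (1 - α) := mul_pos (sub_pos.2 hlt) (by linarith)
    show SelfishMining.optimalValue α γ ρ' < SelfishMining.optimalValue α γ ρ
    linarith
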